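/- Let $n\ge 1$ be an integer and let $P$ be a non-empty finite set of primes; put $k=|P|$ and $b_P=\prod_{p\in P}p$. For $1\le r,s\le n$ and $q\in\mathbb{Q}$ let $\theta_{rs}(q)$ be the $n\times n$ matrix with entry $q$ at position $(r,s)$ that agrees with the identity matrix everywhere else. Let $$K_P=\{\theta_{rs}(1)^{\pm1} : 1\le r<s\le n\}\cup\{\theta_{rr}(p)^{\pm1} : p\in P,\ 1\le r\le n\},$$ let $FG_n(P)$ be the subgroup of $GL_n(\mathbb{Q})$ generated by $K_P$, and let $|f|$ be the word length of $f\in FG_n(P)$ with respect to $K_P$. For an integer $b\ge 2$ and a non-zero rational number $x$ with a finite base $b$ expansion $x=\pm\sum_{i=d_-}^{d_+}\epsilon_i b^i$, where $\epsilon_i\in\{0,\dots,b-1\}$, $\epsilon_{d_-}\ne0$ and $\epsilon_{d_+}\neq 0$, put $d_-^b(x)=d_-$, $d_+^b(x)=d_+$ and $\langle x\rangle_b=1+\max\{|d_-^b(x)|,|d_+^b(x)|\}$; put $\langle 0\rangle_b=0$. Then every diagonal entry of every $f\in FG_n(P)$ has the form $f_{ii}=\prod_{p\in P}p^{c^{(p)}_{ii}}$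 with (unique) integers $c^{(p)}_{ii}$, and every non-zero entry $f_{ij}$ with $i<j$ has a finite base $b_P$ expansion, so that $$\|f\|=\sum_{i=1}^n\sum_{p\in P}|c^{(p)}_{ii}|+\sum_{1\le i<j\le n}\langle f_{ij}\rangle_{b_P}$$ is defined. It is a word metric estimate: there is a real constant $J>0$ (depending only on $n$ and $P$) such that $$\frac1J\,\|f\|\le |f|\le J\,\|f\|\qquad\text{for all } f\in FG_n(P).$$ Explicitly, for all $f\in FG_n(P)$, $$\frac1{J_0}\,\|f\|\le |f|\le J_1\,\|f\|,$$ where $J_0=\max\{n(n-1),\,6^{n-1}(k+1)^{n-1}\}$ and $J_1=\max\{n(n-1),\,6^{n-1}(k+b_P-1)^{n-1}\}$. Since $J_0\le J_1$, one may take $J=J_1$; if $P=\{2\}$ then $J_1=J_0$. -/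

import Mathlib

/-! ### Word length -/

/-- The word length of `g` with respect to a set `S` of group elements: the least length of a
word in the letters of `S` whose product is `g`. (The value is meaningful when such a word exists,
which is the case for all elements of the subgroup generated by `S` if `S` is closed under
inverses.) -/
noncomputable def wordLength {G : Type*} [Group G] (S : Set G) (g : G) : ℕ :=
  sInf {m : ℕ | ∃ w : List G, (∀ x ∈ w, x ∈ S) ∧ w.prod = g ∧ w.length = m}

/-! ### Finite expansions in base `b` and the digit span -/

/-- `|x| = ∑_{i = k}^{l} ε i * b ^ i` is a finite base `b` expansion with digits in
`{0, …, b - 1}`, whose lowest non-zero digit is at position `k` and whose highest non-zero digit is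
at position `l`. (Negative numbers are expanded with a sign in front.) -/
structure IsFiniteExpansion (b : ℕ) (x : ℚ) (k l : ℤ) (ε : ℤ → ℕ) : Prop where
  le : k ≤ l
  digit_lt : ∀ i ∈ Finset.Icc k l, ε i < b
  bottom_ne : ε k ≠ 0
  top_ne : ε l ≠ 0
  sum_eq : |x| = ∑ i ∈ Finset.Icc k l, (ε i : ℚ) * (b : ℚ) ^ i

/-- `x` is a non-zero rational number with a finite base `b` expansion whose lowest and highest
non-zero digits are at the positions `k` and `l`. -/
def HasDigitRange (b : ℕ) (x : ℚ) (k l : ℤ) : Prop :=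
  ∃ ε : ℤ → ℕ, IsFiniteExpansion b x k l ε

open Classical in
/-- `d_-^b(x)`: the position of the lowest non-zero digit in base `b`. -/
noncomputable def dMinus (b : ℕ) (x : ℚ) : ℤ :=
  if h : ∃ k l : ℤ, HasDigitRange b x k l then h.choose else 0

open Classical in
/-- `d_+^b(x)`: the position of the highest non-zero digit in base `b`. -/
noncomputable def dPlus (b : ℕ) (x : ℚ) : ℤ :=
  if h : ∃ l k : ℤ, HasDigitRange b x k l then h.choose else 0

/-- The digit span `⟨x⟩_b = 1 + max (|d_-^b(x)|, |d_+^b(x)|)` for `x ≠ 0`, and `⟨0⟩_b = 0`. -/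
noncomputable def digitSpan (b : ℕ) (x : ℚ) : ℤ :=
  if x = 0 then 0 else 1 + max |dMinus b x| |dPlus b x|

theorem IsFiniteExpansion.sum_lt {b : ℕ} {x : ℚ} {k l : ℤ} {ε : ℤ → ℕ} (hb : 1 < b)
    (h : IsFiniteExpansion b x k l ε) : |x| < (b : ℚ) ^ (l + 1) := by
  have hb0 : (0 : ℚ) < b := by exact_mod_cast (by omega : 0 < b)
  have key : ∀ m : ℤ, k ≤ m → m ≤ l →
      ∑ i ∈ Finset.Icc k m, (ε i : ℚ) * (b : ℚ) ^ i < (b : ℚ) ^ (m + 1) := by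
    intro m hm
    induction m, hm using Int.leInduction with
    | base =>
      intro hl
      have : ((ε k : ℕ) : ℚ) < b := by
        exact_mod_cast h.digit_lt k (Finset.mem_Icc.2 ⟨le_rfl, hl⟩)
      rw [Finset.Icc_self, Finset.sum_singleton, zpow_add_one₀ hb0.ne', mul_comm]
      exact mul_lt_mul_of_pos_left this (zpow_pos hb0 k)
    | succ m hm ih =>
      intro hl
      have h1 := ih (by omega)
      have hd : ((ε (m + 1) : ℕ) : ℚ) + 1 ≤ b := by
        exact_mod_cast h.digit_lt (m + 1) (Finset.mem_Icc.2 ⟨by omega, hl⟩)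
      have hI : Finset.Icc k (m + 1) = insert (m + 1) (Finset.Icc k m) := by
        ext i; simp only [Finset.mem_Icc, Finset.mem_insert]; omega
      rw [hI, Finset.sum_insert (by simp), zpow_add_one₀ hb0.ne' (m + 1)]
      have hp := zpow_pos hb0 (m + 1)
      nlinarith
  rw [h.sum_eq]
  exact key l h.le le_rfl

theorem IsFiniteExpansion.le_abs {b : ℕ} {x : ℚ} {k l : ℤ} {ε : ℤ → ℕ}
    (h : IsFiniteExpansion b x k l ε) : (b : ℚ) ^ l ≤ |x| := by
  have h1 : (1 : ℚ) ≤ ε l := by exact_mod_cast Nat.one_le_iff_ne_zero.2 h.top_ne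
  have hp : (0 : ℚ) ≤ (b : ℚ) ^ l := zpow_nonneg (by positivity) l
  have h2 : (ε l : ℚ) * (b : ℚ) ^ l ≤ ∑ i ∈ Finset.Icc k l, (ε i : ℚ) * (b : ℚ) ^ i :=
    Finset.single_le_sum (f := fun i : ℤ => (ε i : ℚ) * (b : ℚ) ^ i)
      (fun i _ => by positivity) (Finset.mem_Icc.2 ⟨h.le, le_rfl⟩)
  rw [h.sum_eq]
  nlinarith

theorem IsFiniteExpansion.exists_nat {b : ℕ} {x : ℚ} {k l : ℤ} {ε : ℤ → ℕ} (hb : 1 < b)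
    (h : IsFiniteExpansion b x k l ε) : ∃ N : ℕ, |x| = (b : ℚ) ^ k * ((ε k : ℚ) + b * N) := by
  have hb0 : (b : ℚ) ≠ 0 := by exact_mod_cast (by omega : b ≠ 0)
  have key : ∀ m : ℤ, k ≤ m → ∃ N : ℕ,
      ∑ i ∈ Finset.Icc k m, (ε i : ℚ) * (b : ℚ) ^ i = (b : ℚ) ^ k * ((ε k : ℚ) + b * N) := by
    intro m hm
    induction m, hm using Int.leInduction with
    | base => exact ⟨0, by simp [mul_comm]⟩
    | succ m hm ih =>
      obtain ⟨N, hN⟩ := ih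
      obtain ⟨t, ht⟩ := Int.eq_ofNat_of_zero_le (sub_nonneg.2 hm)
      have hI : Finset.Icc k (m + 1) = insert (m + 1) (Finset.Icc k m) := by
        ext i; simp only [Finset.mem_Icc, Finset.mem_insert]; omega
      refine ⟨N + ε (m + 1) * b ^ t, ?_⟩
      have hm' : m + 1 = k + ((t : ℤ) + 1) := by omega
      rw [hI, Finset.sum_insert (by simp), hN]
      have : (b : ℚ) ^ (m + 1) = (b : ℚ) ^ k * ((b : ℚ) ^ t * b) := by
        rw [hm', zpow_add₀ hb0, zpow_add_one₀ hb0, zpow_natCast]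
      rw [this]
      push_cast
      ring
  rw [h.sum_eq]
  exact key l h.le

theorem HasDigitRange.le_bottom {b : ℕ} {x : ℚ} {k l k' l' : ℤ} (hb : 1 < b)
    (h : HasDigitRange b x k l) (h' : HasDigitRange b x k' l') : k' ≤ k := by
  obtain ⟨ε, h⟩ := h
  obtain ⟨ε', h'⟩ := h'
  by_contra hlt
  push Not at hlt
  have hb0 : (b : ℚ) ≠ 0 := by exact_mod_cast (by omega : b ≠ 0)
  obtain ⟨N, hN⟩ := h.exists_nat hb
  obtain ⟨N', hN'⟩ := h'.exists_nat hb
  obtain ⟨t, ht⟩ := Int.eq_ofNat_of_zero_le (by omega : 0 ≤ k' - k - 1)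
  have hk' : k' = k + ((t : ℤ) + 1) := by omega
  rw [hN, hk', zpow_add₀ hb0, zpow_add_one₀ hb0, zpow_natCast, mul_assoc] at hN'
  have h2 := mul_left_cancel₀ (zpow_ne_zero k hb0) hN'
  have h3 : ε k + b * N = b ^ t * b * (ε' (k + (t + 1)) + b * N') := by exact_mod_cast h2
  have h4 : b ∣ ε k := by
    have : b ∣ ε k + b * N := h3 ▸ Dvd.dvd.mul_right (dvd_mul_left b _) _
    exact (Nat.dvd_add_left (dvd_mul_right b N)).1 this
  exact absurd (Nat.le_of_dvd (Nat.pos_of_ne_zero h.bottom_ne) h4)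
    (not_le.2 (h.digit_lt k (Finset.mem_Icc.2 ⟨le_rfl, h.le⟩)))

theorem HasDigitRange.le_top {b : ℕ} {x : ℚ} {k l k' l' : ℤ} (hb : 1 < b)
    (h : HasDigitRange b x k l) (h' : HasDigitRange b x k' l') : l ≤ l' := by
  obtain ⟨ε, h⟩ := h
  obtain ⟨ε', h'⟩ := h'
  have h1 : (b : ℚ) ^ l < (b : ℚ) ^ (l' + 1) := h.le_abs.trans_lt (h'.sum_lt hb)
  have := (zpow_lt_zpow_iff_right₀ (by exact_mod_cast hb : (1 : ℚ) < b)).1 h1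
  omega

/-- `dMinus` is the position of the lowest non-zero digit of any finite expansion. -/
theorem HasDigitRange.dMinus_eq {b : ℕ} {x : ℚ} {k l : ℤ} (hb : 1 < b)
    (h : HasDigitRange b x k l) : dMinus b x = k := by
  have h0 : ∃ k l : ℤ, HasDigitRange b x k l := ⟨k, l, h⟩
  obtain ⟨l', h'⟩ := h0.choose_spec
  rw [dMinus, dif_pos h0]
  exact le_antisymm (h.le_bottom hb h') (h'.le_bottom hb h)

/-- `dPlus` is the position of the highest non-zero digit of any finite expansion. -/
theorem HasDigitRange.dPlus_eq {b : ℕ} {x : ℚ} {k l : ℤ} (hb : 1 < b)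
    (h : HasDigitRange b x k l) : dPlus b x = l := by
  have h0 : ∃ l k : ℤ, HasDigitRange b x k l := ⟨l, k, h⟩
  obtain ⟨k', h'⟩ := h0.choose_spec
  rw [dPlus, dif_pos h0]
  exact le_antisymm (h'.le_top hb h) (h.le_top hb h')

/-! ### The groups `FG_n(P)` -/

/-- The matrix `θ_{rs}(q)`: it has the entry `q` at the position `(r, s)` and agrees with the
identity matrix everywhere else. -/
def theta {n : ℕ} (r s : Fin n) (q : ℚ) : Matrix (Fin n) (Fin n) ℚ :=
  fun i j => if i = r ∧ j = s then q else if i = j then 1 else 0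

/-- The elements `θ_{rs}(1)` and `θ_{rs}(1)⁻¹` of `GL_n(ℚ)`, for `r < s`. -/
def unipotentGenerators (n : ℕ) : Set (GL (Fin n) ℚ) :=
  {g | ∃ r s : Fin n, r < s ∧
    ((g : Matrix (Fin n) (Fin n) ℚ) = theta r s 1 ∨
      ((g⁻¹ : GL (Fin n) ℚ) : Matrix (Fin n) (Fin n) ℚ) = theta r s 1)}

/-- The elements `θ_{rr}(p)` and `θ_{rr}(p)⁻¹` of `GL_n(ℚ)`, for `p ∈ P`. -/
def diagonalGenerators (n : ℕ) (P : Finset ℕ) : Set (GL (Fin n) ℚ) :=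
  {g | ∃ p ∈ P, ∃ r : Fin n,
    ((g : Matrix (Fin n) (Fin n) ℚ) = theta r r (p : ℚ) ∨
      ((g⁻¹ : GL (Fin n) ℚ) : Matrix (Fin n) (Fin n) ℚ) = theta r r (p : ℚ))}

/-- The generating set `K_P`. -/
def generatorsK (n : ℕ) (P : Finset ℕ) : Set (GL (Fin n) ℚ) :=
  unipotentGenerators n ∪ diagonalGenerators n P

/-- The group `FG_n(P)`: the subgroup of `GL_n(ℚ)` generated by `K_P`. -/
def FG (n : ℕ) (P : Finset ℕ) : Subgroup (GL (Fin n) ℚ) :=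
  Subgroup.closure (generatorsK n P)

/-- The word length on `FG_n(P)` with respect to `K_P`. -/
noncomputable def wordLengthFG {n : ℕ} {P : Finset ℕ} (f : FG n P) : ℕ :=
  wordLength (generatorsK n P) (f : GL (Fin n) ℚ)

/-- The `(i, j)` entry of an element of `FG_n(P)`. -/
def entry {n : ℕ} {P : Finset ℕ} (f : FG n P) (i j : Fin n) : ℚ :=
  (f : GL (Fin n) ℚ).val i j

/-- The base `b_P`: the product of the primes in `P`. -/
def baseProd (P : Finset ℕ) : ℕ := ∏ p ∈ P, p

/-- The exponent of the prime `p` in the diagonal entry `f_{ii}`. -/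
def diagExponent {n : ℕ} {P : Finset ℕ} (f : FG n P) (p : ℕ) (i : Fin n) : ℤ :=
  padicValRat p (entry f i i)

/-- The quantity
`‖f‖ = ∑_i ∑_{p ∈ P} |exponent of p in f_{ii}| + ∑_{i < j} ⟨f_{ij}⟩_{b_P}`. -/
noncomputable def metricEstimate {n : ℕ} {P : Finset ℕ} (f : FG n P) : ℤ :=
  (∑ i : Fin n, ∑ p ∈ P, |diagExponent f p i|) +
    ∑ i : Fin n, ∑ j ∈ Finset.Ioi i, digitSpan (baseProd P) (entry f i j)

/-! ### Products of the matrices `θ_{rs}(q)` -/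

/-! Lower bound: along a word the quantities in `IsBoundedTriangular` grow in a controlled way. Each
letter on the left is a row operation that at most multiplies the size of an entry by `b = baseProd
P`, enlarges its denominator by at most a factor `b`, and changes at most one diagonal exponent, by
one. A product of `m` letters therefore has all digits of its entries at positions in `[-m, m]`, and
the sum of its absolute diagonal exponents is at most `m` (`digitSpan_le`,
`isBoundedTriangular_prod`).

Upper bound: an upper triangular matrix is the ordered product of the elementary factors `theta i j
(A i j)`, `i ≤ j`, so it suffices to write each factor cheaply. Diagonal factors cost exactly their
exponents. For `i < j`, conjugation by `theta i i b` scales the unipotent parameter by `b`, so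
Horner's scheme writes the factor at a cost linear in its digit span
(`IsFiniteExpansion.isShortProduct_theta`).

The resulting constants `1 + 2n(n-1)` and `4(k+b-1)` are then absorbed by the exponential terms of
the two maxima. -/

theorem theta_eq_one_add_single {n : ℕ} (r s : Fin n) (q : ℚ) :
    theta r s q = 1 + Matrix.single r s (q - if r = s then 1 else 0) := by
  ext i j
  simp only [theta, Matrix.add_apply, Matrix.one_apply, Matrix.single_apply]
  grind

theorem theta_mul_apply {n : ℕ} (r s : Fin n) (q : ℚ) (B : Matrix (Fin n) (Fin n) ℚ)
    (i j : Fin n) :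
    (theta r s q * B) i j =
      if i = r then (if r = s then q * B r j else B r j + q * B s j) else B i j := by
  rw [theta_eq_one_add_single, Matrix.add_mul, Matrix.one_mul, Matrix.add_apply]
  by_cases hi : i = r
  · subst hi
    rw [Matrix.single_mul_apply_same, if_pos rfl]
    split_ifs with h
    · subst h; ring
    · ring
  · rw [Matrix.single_mul_apply_of_ne _ _ _ _ _ hi, if_neg hi, add_zero]

theorem theta_self_mul_theta_self {n : ℕ} (r : Fin n) (q q' : ℚ) :
    theta r r q * theta r r q' = theta r r (q * q') := by
  ext i j
  rw [theta_mul_apply]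
  simp only [theta]
  grind

theorem theta_mul_theta {n : ℕ} {r s : Fin n} (h : r ≠ s) (x y : ℚ) :
    theta r s x * theta r s y = theta r s (x + y) := by
  ext i j
  rw [theta_mul_apply]
  simp only [theta]
  grind

/-- This relation of Baumslag–Solitar type makes word length proportional to the number of digits of
`x` instead of to its size. -/
theorem theta_self_mul_theta {n : ℕ} {r s : Fin n} (h : r ≠ s) (q x : ℚ) :
    theta r r q * theta r s x = theta r s (q * x) * theta r r q := by
  ext i j
  rw [theta_mul_apply, theta_mul_apply]
  simp only [theta]
  grind

theorem theta_self_one {n : ℕ} (r : Fin n) : theta r r 1 = 1 := by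
  ext i j
  simp only [theta, Matrix.one_apply]
  grind

theorem theta_zero {n : ℕ} {r s : Fin n} (h : r ≠ s) : theta r s 0 = 1 := by
  ext i j
  simp only [theta, Matrix.one_apply]
  grind

/-- `θ_{rs}(x)` as an element of `GL_n(ℚ)`, for `r ≠ s`. -/
def thetaUnipotent {n : ℕ} {r s : Fin n} (h : r ≠ s) (x : ℚ) : GL (Fin n) ℚ where
  val := theta r s x
  inv := theta r s (-x)
  val_inv := by rw [theta_mul_theta h, add_neg_cancel, theta_zero h]
  inv_val := by rw [theta_mul_theta h, neg_add_cancel, theta_zero h]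

/-- `θ_{rr}(q)` as an element of `GL_n(ℚ)`, for `q ≠ 0`. -/
def thetaDiagonal {n : ℕ} (r : Fin n) {q : ℚ} (hq : q ≠ 0) : GL (Fin n) ℚ where
  val := theta r r q
  inv := theta r r q⁻¹
  val_inv := by rw [theta_self_mul_theta_self, mul_inv_cancel₀ hq, theta_self_one]
  inv_val := by rw [theta_self_mul_theta_self, inv_mul_cancel₀ hq, theta_self_one]

/-! ### The generating set -/

theorem mem_unipotentGenerators_iff {n : ℕ} {g : GL (Fin n) ℚ} :
    g ∈ unipotentGenerators n ↔ ∃ r s : Fin n, r < s ∧ ∃ x : ℚ, (x = 1 ∨ x = -1) ∧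
      (g : Matrix (Fin n) (Fin n) ℚ) = theta r s x := by
  constructor
  · rintro ⟨r, s, hrs, h | h⟩
    · exact ⟨r, s, hrs, 1, Or.inl rfl, h⟩
    · refine ⟨r, s, hrs, -1, Or.inr rfl, ?_⟩
      have : g⁻¹ = thetaUnipotent hrs.ne 1 := Units.ext h
      rw [← inv_inv g, this]
      rfl
  · rintro ⟨r, s, hrs, x, rfl | rfl, h⟩
    · exact ⟨r, s, hrs, Or.inl h⟩
    · refine ⟨r, s, hrs, Or.inr ?_⟩
      have : g = thetaUnipotent hrs.ne (-1) := Units.ext h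
      rw [this]
      change theta r s (- -1) = theta r s 1
      rw [neg_neg]

theorem mem_diagonalGenerators_iff {n : ℕ} {P : Finset ℕ} (hP : ∀ p ∈ P, Nat.Prime p)
    {g : GL (Fin n) ℚ} :
    g ∈ diagonalGenerators n P ↔ ∃ p ∈ P, ∃ r : Fin n, ∃ e : ℤ, (e = 1 ∨ e = -1) ∧
      (g : Matrix (Fin n) (Fin n) ℚ) = theta r r ((p : ℚ) ^ e) := by
  constructor
  · rintro ⟨p, hp, r, h | h⟩
    · exact ⟨p, hp, r, 1, Or.inl rfl, by simpa using h⟩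
    · refine ⟨p, hp, r, -1, Or.inr rfl, ?_⟩
      have hp0 : (p : ℚ) ≠ 0 := by exact_mod_cast (hP p hp).ne_zero
      have : g⁻¹ = thetaDiagonal r hp0 := Units.ext h
      rw [← inv_inv g, this, zpow_neg_one]
      rfl
  · rintro ⟨p, hp, r, e, rfl | rfl, h⟩
    · exact ⟨p, hp, r, Or.inl (by simpa using h)⟩
    · refine ⟨p, hp, r, Or.inr ?_⟩
      have hp0 : (p : ℚ) ≠ 0 := by exact_mod_cast (hP p hp).ne_zero
      rw [zpow_neg_one] at h
      have : g = thetaDiagonal r (inv_ne_zero hp0) := Units.ext h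
      rw [this]
      change theta r r (p : ℚ)⁻¹⁻¹ = _
      rw [inv_inv]

theorem inv_mem_generatorsK {n : ℕ} {P : Finset ℕ} {g : GL (Fin n) ℚ}
    (h : g ∈ generatorsK n P) : g⁻¹ ∈ generatorsK n P := by
  rcases h with ⟨r, s, hrs, h⟩ | ⟨p, hp, r, h⟩
  · exact Or.inl ⟨r, s, hrs, by rwa [inv_inv, or_comm]⟩
  · exact Or.inr ⟨p, hp, r, by rwa [inv_inv, or_comm]⟩

theorem exists_word_of_mem_FG {n : ℕ} {P : Finset ℕ} (f : FG n P) :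
    ∃ w : List (GL (Fin n) ℚ), (∀ g ∈ w, g ∈ generatorsK n P) ∧
      w.prod = (f : GL (Fin n) ℚ) ∧ w.length = wordLengthFG f := by
  have hf : (f : GL (Fin n) ℚ) ∈
      (Subgroup.closure (generatorsK n P)).toSubmonoid := f.2
  -- Closure under inverses turns the subgroup closure into a monoid closure, so positive words
  -- exist and the infimum is attained rather than the default value `0` of `sInf ∅`.
  have hinv : (generatorsK n P)⁻¹ = generatorsK n P := by
    ext g
    rw [Set.mem_inv]
    exact ⟨fun h => inv_inv g ▸ inv_mem_generatorsK h, inv_mem_generatorsK⟩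
  rw [Subgroup.closure_toSubmonoid, hinv, Set.union_self] at hf
  obtain ⟨w, hw, hprod⟩ := Submonoid.exists_list_of_mem_closure hf
  have hne : {m : ℕ | ∃ w : List (GL (Fin n) ℚ), (∀ x ∈ w, x ∈ generatorsK n P) ∧
      w.prod = (f : GL (Fin n) ℚ) ∧ w.length = m}.Nonempty := ⟨w.length, w, hw, hprod, rfl⟩
  exact Nat.sInf_mem hne

/-! ### Matrices that are products of at most a given number of generators -/

/-- The matrix `A` is the product of a word of length at most `m` in the letters of `K_P`. -/
def IsShortProduct {n : ℕ} (P : Finset ℕ) (A : Matrix (Fin n) (Fin n) ℚ) (m : ℤ) : Prop :=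
  ∃ w : List (GL (Fin n) ℚ), (∀ g ∈ w, g ∈ generatorsK n P) ∧
    (w.prod : Matrix (Fin n) (Fin n) ℚ) = A ∧ (w.length : ℤ) ≤ m

namespace IsShortProduct

variable {n : ℕ} {P : Finset ℕ} {A B : Matrix (Fin n) (Fin n) ℚ} {m m' : ℤ}

theorem wordLengthFG_le {f : FG n P} (h : IsShortProduct P (f : GL (Fin n) ℚ).val m) :
    (wordLengthFG f : ℤ) ≤ m := by
  obtain ⟨w, hw, hprod, hm⟩ := h
  have : wordLengthFG f ≤ w.length := Nat.sInf_le ⟨w, hw, Units.ext hprod, rfl⟩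
  omega

theorem one : IsShortProduct P (1 : Matrix (Fin n) (Fin n) ℚ) 0 :=
  ⟨[], by simp, by simp, by simp⟩

theorem mul (hA : IsShortProduct P A m) (hB : IsShortProduct P B m') :
    IsShortProduct P (A * B) (m + m') := by
  obtain ⟨w, hw, rfl, hm⟩ := hA
  obtain ⟨w', hw', rfl, hm'⟩ := hB
  refine ⟨w ++ w', ?_, by simp, by push_cast [List.length_append]; omega⟩
  intro g hg
  rcases List.mem_append.1 hg with h | h
  exacts [hw g h, hw' g h]

theorem mono (hA : IsShortProduct P A m) (h : m ≤ m') : IsShortProduct P A m' := by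
  obtain ⟨w, hw, hprod, hm⟩ := hA
  exact ⟨w, hw, hprod, hm.trans h⟩

theorem pow (hA : IsShortProduct P A m) (t : ℕ) : IsShortProduct P (A ^ t) (t * m) := by
  induction t with
  | zero => simpa using one
  | succ t ih =>
    rw [pow_succ]
    exact (ih.mul hA).mono (by push_cast; linarith)

theorem theta_unit {r s : Fin n} (hrs : r < s) {x : ℚ} (hx : x = 1 ∨ x = -1) :
    IsShortProduct P (theta r s x) 1 :=
  ⟨[thetaUnipotent hrs.ne x],
    by
      simp only [List.mem_singleton, forall_eq]
      exact Or.inl (mem_unipotentGenerators_iff.2 ⟨r, s, hrs, x, hx, rfl⟩),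
    by rw [List.prod_singleton]; rfl, by simp⟩

theorem theta_prime (hP : ∀ p ∈ P, Nat.Prime p) (r : Fin n) {p : ℕ} (hp : p ∈ P) {e : ℤ}
    (he : e = 1 ∨ e = -1) : IsShortProduct P (theta r r ((p : ℚ) ^ e)) 1 := by
  have hp0 : (p : ℚ) ≠ 0 := by exact_mod_cast (hP p hp).ne_zero
  refine ⟨[thetaDiagonal r (zpow_ne_zero e hp0)], ?_, by rw [List.prod_singleton]; rfl, by simp⟩
  simp only [List.mem_singleton, forall_eq]
  exact Or.inr ((mem_diagonalGenerators_iff hP).2 ⟨p, hp, r, e, he, rfl⟩)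

theorem theta_self_pow (r : Fin n) (q : ℚ) (t : ℕ) : theta r r q ^ t = theta r r (q ^ t) := by
  induction t with
  | zero => rw [pow_zero, pow_zero, theta_self_one]
  | succ t ih => rw [pow_succ, ih, theta_self_mul_theta_self, pow_succ]

theorem theta_nsmul {r s : Fin n} (h : r ≠ s) (x : ℚ) (t : ℕ) :
    theta r s x ^ t = theta r s (t * x) := by
  induction t with
  | zero => rw [pow_zero, Nat.cast_zero, zero_mul, theta_zero h]
  | succ t ih => rw [pow_succ, ih, theta_mul_theta h]; push_cast; congr 1; ring

theorem theta_prime_zpow (hP : ∀ p ∈ P, Nat.Prime p) (r : Fin n) {p : ℕ} (hp : p ∈ P) (e : ℤ) :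
    IsShortProduct P (theta r r ((p : ℚ) ^ e)) |e| := by
  obtain ⟨t, rfl | rfl⟩ := e.eq_nat_or_neg
  · have := (theta_prime hP r hp (Or.inl rfl)).pow t
    rw [theta_self_pow, ← zpow_natCast, ← zpow_mul] at this
    simpa using this
  · have := (theta_prime hP r hp (Or.inr rfl)).pow t
    rw [theta_self_pow, ← zpow_natCast, ← zpow_mul] at this
    simpa using this

theorem theta_prod_zpow (hP : ∀ p ∈ P, Nat.Prime p) (r : Fin n) (c : ℕ → ℤ) :
    IsShortProduct P (theta r r (∏ p ∈ P, (p : ℚ) ^ c p)) (∑ p ∈ P, |c p|) := by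
  have key : ∀ Q ⊆ P,
      IsShortProduct P (theta r r (∏ p ∈ Q, (p : ℚ) ^ c p)) (∑ p ∈ Q, |c p|) := by
    intro Q
    induction Q using Finset.induction_on with
    | empty => intro _; simpa [theta_self_one] using one
    | insert p Q hp ih =>
      intro hQ
      rw [Finset.prod_insert hp, Finset.sum_insert hp, ← theta_self_mul_theta_self]
      exact (theta_prime_zpow hP r (hQ (Finset.mem_insert_self p Q)) _).mul
        (ih ((Finset.subset_insert p Q).trans hQ))
  exact key P subset_rfl

theorem theta_baseProd_zpow (hP : ∀ p ∈ P, Nat.Prime p) (r : Fin n) (e : ℤ) :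
    IsShortProduct P (theta r r ((baseProd P : ℚ) ^ e)) (P.card * |e|) := by
  have := theta_prod_zpow hP r (fun _ => e)
  rw [Finset.prod_zpow] at this
  simpa [baseProd] using this

theorem theta_digit {r s : Fin n} (hrs : r < s) {x : ℚ} (hx : x = 1 ∨ x = -1) (d : ℕ) :
    IsShortProduct P (theta r s (d * x)) d := by
  have := (theta_unit (P := P) hrs hx).pow d
  rwa [theta_nsmul hrs.ne, mul_one] at this

end IsShortProduct

/-! ### Horner words for unipotent elements -/

theorem one_lt_baseProd {P : Finset ℕ} (hP : ∀ p ∈ P, Nat.Prime p) (hne : P.Nonempty) :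
    1 < baseProd P := by
  obtain ⟨p, hp⟩ := hne
  exact (hP p hp).one_lt.trans_le (Nat.le_of_dvd
    (Finset.prod_pos fun q hq => (hP q hq).pos) (Finset.dvd_prod_of_mem _ hp))

/-- Horner's scheme: go to position `k`, write a digit, move up one position, and repeat up to `l`,
then return to position `0`. A move by one position costs `P.card` letters, a digit at most `b - 1`.
-/
theorem IsFiniteExpansion.isShortProduct_theta {n : ℕ} {P : Finset ℕ}
    (hP : ∀ p ∈ P, Nat.Prime p) (hne : P.Nonempty) {r s : Fin n} (hrs : r < s) {x : ℚ} {k l : ℤ}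
    {ε : ℤ → ℕ} (h : IsFiniteExpansion (baseProd P) x k l ε) :
    IsShortProduct P (theta r s x)
      (P.card * (|k| + (l - k) + |l|) + (l - k + 1) * (baseProd P - 1)) := by
  set b := baseProd P with hb
  have hb0 : (b : ℚ) ≠ 0 := by
    exact_mod_cast (zero_lt_one.trans (one_lt_baseProd hP hne)).ne'
  obtain ⟨σ, hσ, hx⟩ : ∃ σ : ℚ, (σ = 1 ∨ σ = -1) ∧ x = |x| * σ := by
    rcases abs_choice x with h | h
    · exact ⟨1, Or.inl rfl, by rw [h, mul_one]⟩
    · exact ⟨-1, Or.inr rfl, by rw [h]; ring⟩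
  have digit (m : ℤ) (hkm : k ≤ m) (hml : m ≤ l) :
      IsShortProduct P (theta r s (ε m * σ)) (b - 1) := by
    have := h.digit_lt m (Finset.mem_Icc.2 ⟨hkm, hml⟩)
    exact (IsShortProduct.theta_digit hrs hσ (ε m)).mono (by omega)
  have shift (m : ℤ) (y : ℚ) : theta r r ((b : ℚ) ^ m) * theta r s y =
      theta r s ((b : ℚ) ^ m * y) * theta r r ((b : ℚ) ^ m) := theta_self_mul_theta hrs.ne _ _
  -- Invariant: the digits up to position `m` have been written, and the diagonal factor `b ^ m` on
  -- the right is not yet cancelled; a digit written next is scaled by it.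
  have key : ∀ m : ℤ, k ≤ m → m ≤ l → IsShortProduct P
      (theta r s ((∑ i ∈ Finset.Icc k m, (ε i : ℚ) * (b : ℚ) ^ i) * σ) * theta r r ((b : ℚ) ^ m))
      (P.card * (|k| + (m - k)) + (m - k + 1) * (b - 1)) := by
    intro m hm
    induction m, hm using Int.leInduction with
    | base =>
      intro hl
      have := (IsShortProduct.theta_baseProd_zpow hP r k).mul (digit k le_rfl hl)
      rw [← hb, shift] at this
      rw [Finset.Icc_self, Finset.sum_singleton]
      convert this using 1
      · congr 2; ring
      · ring
    | succ m hm ih =>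
      intro hl
      have := ((ih (by omega)).mul (IsShortProduct.theta_baseProd_zpow hP r 1)).mul
        (digit (m + 1) (by omega) hl)
      rw [← hb, mul_assoc (theta r s _), theta_self_mul_theta_self, ← zpow_add₀ hb0, mul_assoc,
        shift, ← mul_assoc, theta_mul_theta hrs.ne] at this
      have hI : Finset.Icc k (m + 1) = insert (m + 1) (Finset.Icc k m) := by
        ext i; simp only [Finset.mem_Icc, Finset.mem_insert]; omega
      rw [hI, Finset.sum_insert (by simp)]
      convert this using 1
      · congr 2; ring
      · rw [abs_one]; ring
  have := (key l h.le le_rfl).mul (IsShortProduct.theta_baseProd_zpow hP r (-l))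
  rw [← hb, mul_assoc, theta_self_mul_theta_self, ← zpow_add₀ hb0, add_neg_cancel, zpow_zero,
    theta_self_one, mul_one, ← h.sum_eq, ← hx] at this
  convert this using 1
  rw [abs_neg]; ring

theorem HasDigitRange.isShortProduct_theta {n : ℕ} {P : Finset ℕ}
    (hP : ∀ p ∈ P, Nat.Prime p) (hne : P.Nonempty) {r s : Fin n} (hrs : r < s) {x : ℚ} {k l : ℤ}
    (h : HasDigitRange (baseProd P) x k l) :
    IsShortProduct P (theta r s x) (4 * (P.card + baseProd P - 1) * (1 + max |k| |l|)) := by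
  obtain ⟨ε, hε⟩ := h
  refine (hε.isShortProduct_theta hP hne hrs).mono ?_
  have hb : (1 : ℤ) < baseProd P := by exact_mod_cast one_lt_baseProd hP hne
  have hc : (0 : ℤ) ≤ P.card := by positivity
  have h1 : |k| + (l - k) + |l| ≤ 4 * (1 + max |k| |l|) := by
    have := le_max_left |k| |l|
    have := le_max_right |k| |l|
    have := neg_abs_le k
    have := le_abs_self l
    linarith
  have h2 : l - k + 1 ≤ 4 * (1 + max |k| |l|) := by
    have := le_max_left |k| |l|
    have := le_max_right |k| |l|
    have := neg_abs_le k
    have := le_abs_self l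
    have := abs_nonneg k
    linarith
  nlinarith [mul_le_mul_of_nonneg_left h1 hc,
    mul_le_mul_of_nonneg_right h2 (by linarith : (0 : ℤ) ≤ baseProd P - 1)]

/-! ### Existence of finite expansions -/

theorem sum_Icc_add_natCast (g : ℤ → ℚ) (k : ℤ) (t : ℕ) :
    ∑ i ∈ Finset.Icc k (k + t), g i = ∑ j ∈ Finset.range (t + 1), g (k + j) := by
  induction t with
  | zero => simp
  | succ t ih =>
    have hI : Finset.Icc k (k + ((t + 1 : ℕ) : ℤ)) =
        insert (k + ((t + 1 : ℕ) : ℤ)) (Finset.Icc k (k + t)) := by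
      ext i; simp only [Finset.mem_Icc, Finset.mem_insert]; push_cast; omega
    rw [hI, Finset.sum_insert (by simp), ih, Finset.sum_range_succ _ (t + 1), add_comm]

theorem sum_range_digits (N b t : ℕ) :
    ∑ i ∈ Finset.range t, (N / b ^ i % b) * b ^ i = N % b ^ t := by
  induction t with
  | zero => simp [Nat.mod_one]
  | succ t ih => rw [Finset.sum_range_succ, ih, Nat.mod_pow_succ, mul_comm (b ^ t)]

/-- Removing the largest power `b ^ v` from `b ^ m * |x|` leaves a natural number not divisible by
`b`, whose lowest digit is thus non-zero. Since `v ≥ 0`, the bottom position `v - m` is at least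
`-m`. -/
theorem exists_hasDigitRange {b : ℕ} (hb : 1 < b) {x : ℚ} (hx : x ≠ 0) {m : ℕ} {z : ℤ}
    (hz : (b : ℚ) ^ m * x = z) : ∃ k l : ℤ, HasDigitRange b x k l ∧ -(m : ℤ) ≤ k := by
  have hb0 : (b : ℚ) ≠ 0 := by exact_mod_cast (by omega : b ≠ 0)
  have hz0 : z ≠ 0 := by
    rintro rfl
    simp [hx, hb0] at hz
  obtain ⟨v, N, hN, hzN⟩ := Nat.exists_eq_pow_mul_and_not_dvd (Int.natAbs_ne_zero.2 hz0) b hb.ne'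
  have hN0 : N ≠ 0 := by rintro rfl; exact hN (dvd_zero b)
  have hxN : |x| = (b : ℚ) ^ (-(m : ℤ) + v) * N := by
    have h1 : (b : ℚ) ^ m * |x| = b ^ v * N := by
      have h2 : ((z.natAbs : ℕ) : ℚ) = |(z : ℚ)| := by
        rw [Nat.cast_natAbs]; push_cast; rfl
      rw [← Nat.cast_pow, ← Nat.cast_pow, ← Nat.cast_mul (b ^ v), ← hzN, h2, ← hz, abs_mul]
      simp
    rw [zpow_add₀ hb0, zpow_neg, zpow_natCast, zpow_natCast, mul_assoc, ← h1,
      inv_mul_cancel_left₀ (pow_ne_zero m hb0)]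
  set k : ℤ := -(m : ℤ) + v with hk
  refine ⟨k, k + (Nat.log b N : ℕ),
    ⟨fun i => N / b ^ (i - k).toNat % b, by omega, ?_, ?_, ?_, ?_⟩, by omega⟩
  · exact fun i _ => Nat.mod_lt _ (by omega)
  · simpa [Nat.dvd_iff_mod_eq_zero] using hN
  · have h1 : N / b ^ Nat.log b N < b := by
      rw [Nat.div_lt_iff_lt_mul (by positivity), ← pow_succ']
      exact Nat.lt_pow_succ_log_self hb N
    have h2 : 0 < N / b ^ Nat.log b N := Nat.div_pos (Nat.pow_log_le_self b hN0) (by positivity)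
    simp only [add_sub_cancel_left, Int.toNat_natCast]
    rw [Nat.mod_eq_of_lt h1]
    exact h2.ne'
  · rw [sum_Icc_add_natCast, hxN]
    have h1 := sum_range_digits N b (Nat.log b N + 1)
    rw [Nat.mod_eq_of_lt (Nat.lt_pow_succ_log_self hb N)] at h1
    have h2 : (N : ℚ) = ∑ i ∈ Finset.range (Nat.log b N + 1),
        ((N / b ^ i % b : ℕ) : ℚ) * (b : ℚ) ^ i := by
      exact_mod_cast h1.symm
    refine (congrArg (_ * ·) h2).trans ?_
    rw [Finset.mul_sum]
    refine Finset.sum_congr rfl fun j _ => ?_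
    simp only [add_sub_cancel_left, Int.toNat_natCast]
    rw [zpow_add₀ hb0 k, zpow_natCast]
    ring

/-- Integrality of `b ^ m * x` bounds the lowest position from below by `-m`, the size of `x` bounds
the highest one from above by `m`, and `k ≤ l` traps both in between. -/
theorem digitSpan_le {b : ℕ} (hb : 1 < b) {x : ℚ} (hx : x ≠ 0) {m : ℕ} {z : ℤ}
    (hz : (b : ℚ) ^ m * x = z) (hm : |x| ≤ (b : ℚ) ^ m) : digitSpan b x ≤ 1 + m := by
  obtain ⟨k, l, h, hk⟩ := exists_hasDigitRange hb hx hz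
  rw [digitSpan, if_neg hx, h.dMinus_eq hb, h.dPlus_eq hb]
  obtain ⟨ε, hε⟩ := h
  have h1 : (b : ℚ) ^ l ≤ (b : ℚ) ^ (m : ℤ) := by simpa using hε.le_abs.trans hm
  have h2 := (zpow_le_zpow_iff_right₀ (by exact_mod_cast hb : (1 : ℚ) < b)).1 h1
  have h3 := hε.le
  have : max |k| |l| ≤ (m : ℤ) :=
    max_le (abs_le.2 ⟨by omega, by omega⟩) (abs_le.2 ⟨by omega, by omega⟩)
  omega

theorem digitSpan_nonneg (b : ℕ) (x : ℚ) : 0 ≤ digitSpan b x := by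
  rw [digitSpan]
  split_ifs
  · exact le_rfl
  · positivity

/-! ### Entries of products of generators -/

/-- Size bounds that hold for all products of at most `m` generators. -/
structure IsBoundedTriangular {n : ℕ} (P : Finset ℕ) (A : Matrix (Fin n) (Fin n) ℚ) (m : ℕ) :
    Prop where
  lower_eq_zero : ∀ i j : Fin n, j < i → A i j = 0
  diag : ∃ c : Fin n → ℕ → ℤ, (∀ i, A i i = ∏ p ∈ P, (p : ℚ) ^ c i p) ∧
    ∑ i, ∑ p ∈ P, |c i p| ≤ m
  abs_le : ∀ i j, |A i j| ≤ (baseProd P : ℚ) ^ m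
  integral : ∀ i j, ∃ z : ℤ, (baseProd P : ℚ) ^ m * A i j = z

theorem isBoundedTriangular_one {n : ℕ} (P : Finset ℕ) :
    IsBoundedTriangular P (1 : Matrix (Fin n) (Fin n) ℚ) 0 where
  lower_eq_zero i j h := Matrix.one_apply_ne h.ne'
  diag := ⟨fun _ _ => 0, by simp, by simp⟩
  abs_le i j := by
    rw [Matrix.one_apply]
    split_ifs <;> simp
  integral i j := ⟨if i = j then 1 else 0, by rw [Matrix.one_apply]; split_ifs <;> simp⟩

namespace IsBoundedTriangular

variable {n : ℕ} {P : Finset ℕ} {A : Matrix (Fin n) (Fin n) ℚ} {m : ℕ}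

theorem abs_le_succ (hP : ∀ p ∈ P, Nat.Prime p) (hne : P.Nonempty)
    (h : IsBoundedTriangular P A m) (i j : Fin n) : |A i j| ≤ (baseProd P : ℚ) ^ (m + 1) :=
  (h.abs_le i j).trans
    (pow_le_pow_right₀ (by exact_mod_cast (one_lt_baseProd hP hne).le) m.le_succ)

theorem integral_succ (h : IsBoundedTriangular P A m) (i j : Fin n) :
    ∃ z : ℤ, (baseProd P : ℚ) ^ (m + 1) * A i j = z := by
  obtain ⟨z, hz⟩ := h.integral i j
  exact ⟨z * baseProd P, by push_cast; rw [← hz]; ring⟩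

/-- Adding or subtracting a row at most doubles the bound on the entries, and `2 ≤ baseProd P`. The
diagonal is unaffected because row `s` vanishes in column `r`. -/
theorem theta_unit_mul (hP : ∀ p ∈ P, Nat.Prime p) (hne : P.Nonempty)
    (h : IsBoundedTriangular P A m) {r s : Fin n} (hrs : r < s) {x : ℚ} (hx : x = 1 ∨ x = -1) :
    IsBoundedTriangular P (theta r s x * A) (m + 1) where
  lower_eq_zero i j hij := by
    rw [theta_mul_apply, if_neg hrs.ne]
    split_ifs with hi
    · subst hi
      rw [h.lower_eq_zero i j hij, h.lower_eq_zero s j (hij.trans hrs), mul_zero, add_zero]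
    · exact h.lower_eq_zero i j hij
  diag := by
    obtain ⟨c, hc, hsum⟩ := h.diag
    refine ⟨c, fun i => ?_, hsum.trans (by push_cast; omega)⟩
    rw [theta_mul_apply, if_neg hrs.ne, ← hc]
    split_ifs with hi
    · subst hi
      rw [h.lower_eq_zero s i hrs, mul_zero, add_zero]
    · rfl
  abs_le i j := by
    rw [theta_mul_apply, if_neg hrs.ne]
    split_ifs with hi
    · have h1 := h.abs_le r j
      have h2 := h.abs_le s j
      have h3 : |x| = 1 := by rcases hx with rfl | rfl <;> simp
      have h4 : |x * A s j| = |A s j| := by rw [abs_mul, h3, one_mul]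
      have hb : (2 : ℚ) ≤ baseProd P := by exact_mod_cast one_lt_baseProd hP hne
      have h5 : (0 : ℚ) ≤ (baseProd P : ℚ) ^ m := by positivity
      rw [pow_succ]
      nlinarith [abs_add_le (A r j) (x * A s j)]
    · exact h.abs_le_succ hP hne i j
  integral i j := by
    rw [theta_mul_apply, if_neg hrs.ne]
    split_ifs with hi
    · obtain ⟨z, hz⟩ := h.integral_succ r j
      obtain ⟨y, hy⟩ := h.integral_succ s j
      rcases hx with rfl | rfl
      · exact ⟨z + y, by push_cast; rw [← hz, ← hy]; ring⟩
      · exact ⟨z - y, by push_cast; rw [← hz, ← hy]; ring⟩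
    · exact h.integral_succ i j

theorem theta_prime_mul (hP : ∀ p ∈ P, Nat.Prime p) (hne : P.Nonempty)
    (h : IsBoundedTriangular P A m) {p : ℕ} (hp : p ∈ P) (r : Fin n) {e : ℤ}
    (he : e = 1 ∨ e = -1) :
    IsBoundedTriangular P (theta r r ((p : ℚ) ^ e) * A) (m + 1) where
  lower_eq_zero i j hij := by
    rw [theta_mul_apply, if_pos rfl]
    split_ifs with hi
    · rw [← hi, h.lower_eq_zero i j hij, mul_zero]
    · exact h.lower_eq_zero i j hij
  diag := by
    obtain ⟨c, hc, hsum⟩ := h.diag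
    refine ⟨fun i q => c i q + if i = r ∧ q = p then e else 0, fun i => ?_, ?_⟩
    · rw [theta_mul_apply, if_pos rfl]
      split_ifs with hi
      · subst hi
        rw [hc i, ← Finset.mul_prod_erase P _ hp, ← Finset.mul_prod_erase P _ hp]
        have hp0 : (p : ℚ) ≠ 0 := by exact_mod_cast (hP p hp).ne_zero
        simp only [and_self, if_true]
        rw [zpow_add₀ hp0, ← mul_assoc, mul_comm ((p : ℚ) ^ e)]
        congr 1
        refine Finset.prod_congr rfl fun q hq => ?_
        simp [Finset.ne_of_mem_erase hq]
      · simp [hi, hc i]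
    · have h1 : |e| = 1 := by rcases he with rfl | rfl <;> simp
      calc ∑ i, ∑ q ∈ P, |c i q + if i = r ∧ q = p then e else 0|
          -- The condition is nested so that the sums over `q` and then `i` collapse one at a time.
          ≤ ∑ i, ∑ q ∈ P, (|c i q| + if q = p then if i = r then 1 else 0 else 0) := by
            refine Finset.sum_le_sum fun i _ => Finset.sum_le_sum fun q _ => ?_
            refine (abs_add_le _ _).trans (add_le_add le_rfl ?_)
            split_ifs <;> simp_all
        _ = (∑ i, ∑ q ∈ P, |c i q|) + 1 := by
            simp only [Finset.sum_add_distrib, Finset.sum_ite_eq', hp, if_true,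
              Finset.mem_univ]
        _ ≤ ((m + 1 : ℕ) : ℤ) := by push_cast; linarith
  abs_le i j := by
    rw [theta_mul_apply, if_pos rfl]
    split_ifs with hi
    · have h1 : |(p : ℚ) ^ e| ≤ baseProd P := by
        have hb : (1 : ℚ) < baseProd P := by exact_mod_cast one_lt_baseProd hP hne
        have hp1 : (1 : ℚ) < p := by exact_mod_cast (hP p hp).one_lt
        have hpb : (p : ℚ) ≤ baseProd P := by
          exact_mod_cast Nat.le_of_dvd (zero_lt_one.trans (one_lt_baseProd hP hne))
            (Finset.dvd_prod_of_mem _ hp)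
        rw [abs_of_pos (by positivity)]
        rcases he with rfl | rfl
        · rwa [zpow_one]
        · rw [zpow_neg_one]
          exact (inv_le_one_of_one_le₀ hp1.le).trans hb.le
      rw [abs_mul, pow_succ']
      exact mul_le_mul h1 (h.abs_le r j) (abs_nonneg _) (by positivity)
    · exact h.abs_le_succ hP hne i j
  integral i j := by
    rw [theta_mul_apply, if_pos rfl]
    split_ifs with hi
    · rcases he with rfl | rfl
      · obtain ⟨z, hz⟩ := h.integral_succ r j
        exact ⟨z * p, by push_cast; rw [← hz, zpow_one]; ring⟩
      · obtain ⟨z, hz⟩ := h.integral r j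
        -- Division by `p` is compensated by the additional factor `baseProd P = p * d`.
        obtain ⟨d, hd⟩ : p ∣ baseProd P := Finset.dvd_prod_of_mem _ hp
        have hp0 : (p : ℚ) ≠ 0 := by exact_mod_cast (hP p hp).ne_zero
        have hd' : (baseProd P : ℚ) = p * d := by exact_mod_cast hd
        refine ⟨z * d, ?_⟩
        push_cast
        rw [← hz, pow_succ, zpow_neg_one]
        nth_rewrite 2 [hd']
        field_simp
    · exact h.integral_succ i j

end IsBoundedTriangular

theorem isBoundedTriangular_prod {n : ℕ} {P : Finset ℕ} (hP : ∀ p ∈ P, Nat.Prime p)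
    (hne : P.Nonempty) (w : List (GL (Fin n) ℚ)) (hw : ∀ g ∈ w, g ∈ generatorsK n P) :
    IsBoundedTriangular P (w.prod : Matrix (Fin n) (Fin n) ℚ) w.length := by
  induction w with
  | nil => simpa using isBoundedTriangular_one P
  | cons g w ih =>
    have ih' := ih fun g hg => hw g (List.mem_cons_of_mem _ hg)
    rw [List.prod_cons, Units.val_mul, List.length_cons]
    rcases hw g List.mem_cons_self with hg | hg
    · obtain ⟨r, s, hrs, x, hx, hgx⟩ := mem_unipotentGenerators_iff.1 hg
      rw [hgx]
      exact ih'.theta_unit_mul hP hne hrs hx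
    · obtain ⟨p, hp, r, e, he, hge⟩ := (mem_diagonalGenerators_iff hP).1 hg
      rw [hge]
      exact ih'.theta_prime_mul hP hne hp r he

theorem isBoundedTriangular_val {n : ℕ} {P : Finset ℕ} (hP : ∀ p ∈ P, Nat.Prime p)
    (hne : P.Nonempty) (f : FG n P) :
    IsBoundedTriangular P (f : GL (Fin n) ℚ).val (wordLengthFG f) := by
  obtain ⟨w, hw, hprod, hlen⟩ := exists_word_of_mem_FG f
  rw [← hlen, ← hprod]
  exact isBoundedTriangular_prod hP hne w hw

/-- Identifies the exponents accumulated along a word with the valuations that define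
`diagExponent`. -/
theorem padicValRat_prod_zpow {P : Finset ℕ} (hP : ∀ p ∈ P, Nat.Prime p) (c : ℕ → ℤ) {p : ℕ}
    (hp : p ∈ P) : padicValRat p (∏ q ∈ P, (q : ℚ) ^ c q) = c p := by
  have : Fact p.Prime := ⟨hP p hp⟩
  have key : ∀ Q ⊆ P, padicValRat p (∏ q ∈ Q, (q : ℚ) ^ c q) = if p ∈ Q then c p else 0 := by
    intro Q
    induction Q using Finset.induction_on with
    | empty => simp
    | insert q Q hq ih =>
      intro hQ
      have hqP : q ∈ P := hQ (Finset.mem_insert_self q Q)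
      have : Fact q.Prime := ⟨hP q hqP⟩
      have h0 : ∀ q ∈ P, (q : ℚ) ^ c q ≠ 0 := fun q hq =>
        zpow_ne_zero _ (by exact_mod_cast (hP q hq).ne_zero)
      have hQP : Q ⊆ P := (Finset.subset_insert q Q).trans hQ
      rw [Finset.prod_insert hq, padicValRat.mul (h0 q hqP)
        (Finset.prod_ne_zero_iff.2 fun i hi => h0 i (hQP hi)), ih hQP, padicValRat.zpow,
        padicValRat.of_nat]
      by_cases hpq : p = q
      · subst hpq
        simp [hq]
      · simp [padicValNat_primes hpq, hpq]
  rw [key P subset_rfl, if_pos hp]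

theorem exists_diagExponent {n : ℕ} {P : Finset ℕ} (hP : ∀ p ∈ P, Nat.Prime p)
    (hne : P.Nonempty) (f : FG n P) :
    (∀ i, entry f i i = ∏ p ∈ P, (p : ℚ) ^ diagExponent f p i) ∧
      ∑ i, ∑ p ∈ P, |diagExponent f p i| ≤ wordLengthFG f := by
  obtain ⟨c, hc, hsum⟩ := (isBoundedTriangular_val hP hne f).diag
  have hc' : ∀ i, ∀ p ∈ P, diagExponent f p i = c i p := fun i p hp => by
    rw [diagExponent, entry, hc i, padicValRat_prod_zpow hP (c i) hp]
  constructor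
  · intro i
    rw [entry, hc i]
    exact Finset.prod_congr rfl fun p hp => by rw [hc' i p hp]
  · refine le_trans (le_of_eq ?_) hsum
    exact Finset.sum_congr rfl fun i _ => Finset.sum_congr rfl fun p hp => by rw [hc' i p hp]

theorem hasDigitRange_entry {n : ℕ} {P : Finset ℕ} (hP : ∀ p ∈ P, Nat.Prime p)
    (hne : P.Nonempty) (f : FG n P) {i j : Fin n} (h : entry f i j ≠ 0) :
    HasDigitRange (baseProd P) (entry f i j)
      (dMinus (baseProd P) (entry f i j)) (dPlus (baseProd P) (entry f i j)) := by
  obtain ⟨z, hz⟩ := (isBoundedTriangular_val hP hne f).integral i j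
  have hb := one_lt_baseProd hP hne
  obtain ⟨k, l, hkl, -⟩ := exists_hasDigitRange hb h hz
  rwa [hkl.dMinus_eq hb, hkl.dPlus_eq hb]

/-! ### The lower bound for the word length -/

theorem digitSpan_entry_le {n : ℕ} {P : Finset ℕ} (hP : ∀ p ∈ P, Nat.Prime p)
    (hne : P.Nonempty) (f : FG n P) {i j : Fin n} (hij : i < j) :
    digitSpan (baseProd P) (entry f i j) ≤ 2 * wordLengthFG f := by
  have hf := isBoundedTriangular_val hP hne f
  by_cases h0 : entry f i j = 0
  · rw [digitSpan, if_pos h0]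
    positivity
  · obtain ⟨z, hz⟩ := hf.integral i j
    have h1 := digitSpan_le (one_lt_baseProd hP hne) h0 hz (hf.abs_le i j)
    -- A non-zero off-diagonal entry excludes the empty word, so `1 + m ≤ 2 * m` for the word length
    -- `m`.
    have h2 : wordLengthFG f ≠ 0 := by
      intro h2
      obtain ⟨w, -, hprod, hlen⟩ := exists_word_of_mem_FG f
      rw [h2, List.length_eq_zero_iff] at hlen
      rw [hlen, List.prod_nil] at hprod
      apply h0
      rw [entry, ← hprod]
      exact Matrix.one_apply_ne hij.ne
    omega

theorem metricEstimate_le {n : ℕ} {P : Finset ℕ} (hP : ∀ p ∈ P, Nat.Prime p)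
    (hne : P.Nonempty) (f : FG n P) :
    metricEstimate f ≤ (1 + 2 * (n * (n - 1 : ℕ))) * wordLengthFG f := by
  have h1 : ∀ i : Fin n, ∑ j ∈ Finset.Ioi i, digitSpan (baseProd P) (entry f i j) ≤
      (n - 1 : ℕ) * (2 * wordLengthFG f) := by
    intro i
    calc ∑ j ∈ Finset.Ioi i, digitSpan (baseProd P) (entry f i j)
        ≤ ∑ j ∈ Finset.Ioi i, (2 * wordLengthFG f : ℤ) :=
          Finset.sum_le_sum fun j hj => digitSpan_entry_le hP hne f (Finset.mem_Ioi.1 hj)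
      _ = (n - 1 - i : ℕ) * (2 * wordLengthFG f) := by simp
      _ ≤ (n - 1 : ℕ) * (2 * wordLengthFG f) :=
          mul_le_mul_of_nonneg_right (by omega) (by positivity)
  have h2 := Finset.sum_le_sum fun i (_ : i ∈ Finset.univ) => h1 i
  rw [Finset.sum_const, Finset.card_univ, Fintype.card_fin, nsmul_eq_mul] at h2
  rw [metricEstimate]
  linarith [(exists_diagExponent hP hne f).2]

/-! ### The upper bound for the word length -/

/-- The matrix with the entries of `A` at the positions in `S` (given as column, row) and the
entries of the identity matrix elsewhere. -/
def partialMatrix {n : ℕ} (A : Matrix (Fin n) (Fin n) ℚ) (S : Finset (Fin n ×ₗ Fin n)) :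
    Matrix (Fin n) (Fin n) ℚ :=
  fun i j => if toLex (j, i) ∈ S then A i j else (1 : Matrix (Fin n) (Fin n) ℚ) i j

/-- Positions are filled in by column, then by row. When `(i, t)` is reached, row `t` is still a row
of the identity, so the row operation alters only that position; for `i = t` it scales the diagonal
`1`. -/
theorem theta_mul_partialMatrix {n : ℕ} {A : Matrix (Fin n) (Fin n) ℚ}
    (hA : ∀ i j : Fin n, j < i → A i j = 0) {S : Finset (Fin n ×ₗ Fin n)} {i t : Fin n}
    (hit : i ≤ t) (hS : ∀ a ∈ S, a < toLex (t, i)) :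
    theta i t (A i t) * partialMatrix A S = partialMatrix A (insert (toLex (t, i)) S) := by
  have row (j : Fin n) : partialMatrix A S t j = (1 : Matrix (Fin n) (Fin n) ℚ) t j := by
    rw [partialMatrix]
    split_ifs with h
    · rcases Prod.Lex.toLex_lt_toLex.1 (hS _ h) with h1 | h1
      · rw [hA t j h1, Matrix.one_apply_ne h1.ne']
      · exact absurd h1.2 (not_lt.2 hit)
    · rfl
  have hmem : toLex (t, i) ∉ S := fun h => (hS _ h).false
  have ne {j r : Fin n} (h : ¬(j = t ∧ r = i)) : toLex (j, r) ≠ toLex (t, i) := fun h' =>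
    h (by simpa using h')
  ext r j
  rw [theta_mul_apply]
  simp only [row, Matrix.one_apply]
  by_cases hr : r = i
  · subst hr
    rw [if_pos rfl]
    by_cases hj : j = t
    · subst hj
      simp only [partialMatrix, hmem, Finset.mem_insert_self, Matrix.one_apply]
      by_cases hrj : r = j <;> simp [hrj]
    · have := ne (fun h => hj h.1 : ¬(j = t ∧ r = r))
      by_cases hrt : r = t
      · subst hrt
        rw [if_pos rfl, row j, Matrix.one_apply_ne (Ne.symm hj), mul_zero]
        have h2 := row j
        simp only [partialMatrix, Matrix.one_apply_ne (Ne.symm hj)] at h2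
        simpa [partialMatrix, this, Ne.symm hj] using h2.symm
      · simp [partialMatrix, this, hrt, Ne.symm hj]
  · have := ne (fun h => hr h.2 : ¬(j = t ∧ r = i))
    simp [partialMatrix, this, hr]

/-- An upper triangular matrix is the product of the matrices `θ_{ij}(A_{ij})`, `i ≤ j`, in a
suitable order, so word length bounds for these factors add up. -/
theorem IsShortProduct.of_upper_triangular {n : ℕ} {P : Finset ℕ}
    {A : Matrix (Fin n) (Fin n) ℚ} (hA : ∀ i j : Fin n, j < i → A i j = 0)
    {cost : Fin n → Fin n → ℤ}
    (hcost : ∀ i j, i ≤ j → IsShortProduct P (theta i j (A i j)) (cost i j))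
    (hcost0 : ∀ i j, j < i → cost i j = 0) :
    IsShortProduct P A (∑ i, ∑ j, cost i j) := by
  have key : ∀ S : Finset (Fin n ×ₗ Fin n), IsShortProduct P (partialMatrix A S)
      (∑ a ∈ S, cost (ofLex a).2 (ofLex a).1) := by
    intro S
    induction S using Finset.induction_on_max with
    | empty =>
      have : partialMatrix A ∅ = 1 := by ext; simp [partialMatrix]
      rw [this]
      simpa using IsShortProduct.one
    | insert a S hS ih =>
      obtain ⟨⟨t, i⟩, rfl⟩ := toLex.surjective a
      rw [Finset.sum_insert fun h => (hS _ h).false]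
      rcases le_or_gt i t with hit | hit
      · rw [← theta_mul_partialMatrix hA hit hS]
        exact (hcost i t hit).mul ih
      -- Below the diagonal `A` and the identity both vanish, so no factor is needed.
      · have : partialMatrix A (insert (toLex (t, i)) S) = partialMatrix A S := by
          ext r j
          simp only [partialMatrix, Finset.mem_insert, EmbeddingLike.apply_eq_iff_eq,
            Prod.mk.injEq]
          by_cases h : j = t ∧ r = i
          · obtain ⟨rfl, rfl⟩ := h
            simp [hA r j hit, Matrix.one_apply_ne hit.ne']
          · simp [h]
        rw [this]
        simpa [hcost0 i t hit] using ih
  have h1 : partialMatrix A Finset.univ = A := by ext; simp [partialMatrix]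
  have h2 : ∑ a : Fin n ×ₗ Fin n, cost (ofLex a).2 (ofLex a).1 = ∑ i, ∑ j, cost i j := by
    rw [Finset.sum_comm, ← Fintype.sum_prod_type']
    exact Fintype.sum_equiv ofLex _ _ fun _ => rfl
  have h3 := key Finset.univ
  rwa [h1, h2] at h3

theorem wordLengthFG_le_sum {n : ℕ} {P : Finset ℕ} (hP : ∀ p ∈ P, Nat.Prime p)
    (hne : P.Nonempty) (f : FG n P) :
    (wordLengthFG f : ℤ) ≤ (∑ i : Fin n, ∑ p ∈ P, |diagExponent f p i|) +
      4 * (P.card + baseProd P - 1) *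
        ∑ i : Fin n, ∑ j ∈ Finset.Ioi i, digitSpan (baseProd P) (entry f i j) := by
  set C : ℤ := 4 * (P.card + baseProd P - 1)
  have h := IsShortProduct.of_upper_triangular (P := P)
    (cost := fun i j => (if i = j then ∑ p ∈ P, |diagExponent f p i| else 0) +
      if j ∈ Finset.Ioi i then C * digitSpan (baseProd P) (entry f i j) else 0)
    (isBoundedTriangular_val hP hne f).lower_eq_zero ?_ ?_
  · refine h.wordLengthFG_le.trans (le_of_eq ?_)
    simp only [Finset.sum_add_distrib, Finset.sum_ite_eq, Finset.mem_univ, if_true,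
      Finset.sum_ite_mem, Finset.univ_inter, Finset.mul_sum]
  · intro i j hij
    rcases hij.eq_or_lt with rfl | hij
    · simp only [if_true, Finset.mem_Ioi, lt_irrefl, if_false, add_zero]
      rw [← entry, (exists_diagExponent hP hne f).1 i]
      exact IsShortProduct.theta_prod_zpow hP i _
    · simp only [hij.ne, if_false, Finset.mem_Ioi, hij, if_true, zero_add]
      rw [← entry]
      by_cases h0 : entry f i j = 0
      · rw [h0, theta_zero hij.ne, digitSpan, if_pos rfl, mul_zero]
        exact IsShortProduct.one
      · rw [digitSpan, if_neg h0]
        exact (hasDigitRange_entry hP hne f h0).isShortProduct_theta hP hne hij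
  · intro i j hij
    simp [hij.ne', hij.le]

/-! ### Comparison with the explicit constants -/

/-- With `n = m + 1` the left side is the constant of `metricEstimate_le`; the base is `12 = 6 * 2`,
where `2 ≤ P.card + 1`. -/
theorem one_add_two_mul_le_pow (m : ℕ) : 1 + 2 * ((m + 1) * m) ≤ 12 ^ m := by
  induction m with
  | zero => simp
  | succ m ih =>
    rw [pow_succ]
    nlinarith

theorem mainTheorem1 (n : ℕ) (hn : 1 ≤ n) (P : Finset ℕ) (hP : ∀ p ∈ P, Nat.Prime p)
    (hne : P.Nonempty) :
    -- the quantities that enter the estimate are well defined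
    (∀ f : FG n P,
      (∀ i : Fin n, entry f i i = ∏ p ∈ P, (p : ℚ) ^ diagExponent f p i) ∧
      (∀ i j : Fin n, i < j → entry f i j ≠ 0 →
        HasDigitRange (baseProd P) (entry f i j)
          (dMinus (baseProd P) (entry f i j)) (dPlus (baseProd P) (entry f i j)))) ∧
    -- the estimate is bi-Lipschitz equivalent to word length
    (∃ J : ℝ, 0 < J ∧ ∀ f : FG n P,
      1 / J * (metricEstimate f : ℝ) ≤ (wordLengthFG f : ℝ) ∧
      (wordLengthFG f : ℝ) ≤ J * (metricEstimate f : ℝ)) ∧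
    -- explicit constants
    (∀ f : FG n P,
      1 / max ((n : ℝ) * ((n : ℝ) - 1)) (6 ^ (n - 1) * ((P.card : ℝ) + 1) ^ (n - 1)) *
          (metricEstimate f : ℝ) ≤ (wordLengthFG f : ℝ) ∧
      (wordLengthFG f : ℝ) ≤
        max ((n : ℝ) * ((n : ℝ) - 1))
            (6 ^ (n - 1) * ((P.card : ℝ) + (baseProd P : ℝ) - 1) ^ (n - 1)) *
          (metricEstimate f : ℝ)) := by
  obtain ⟨m, rfl⟩ : ∃ m, n = m + 1 := ⟨n - 1, by omega⟩
  have hb : (2 : ℝ) ≤ baseProd P := by exact_mod_cast one_lt_baseProd hP hne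
  have hk : (1 : ℝ) ≤ P.card := by exact_mod_cast hne.card_pos
  simp only [Nat.add_sub_cancel]
  set J₀ : ℝ := max (((m + 1 : ℕ) : ℝ) * (((m + 1 : ℕ) : ℝ) - 1)) (6 ^ m * ((P.card : ℝ) + 1) ^ m)
    with hJ₀
  set J₁ : ℝ := max (((m + 1 : ℕ) : ℝ) * (((m + 1 : ℕ) : ℝ) - 1))
    (6 ^ m * ((P.card : ℝ) + (baseProd P : ℝ) - 1) ^ m) with hJ₁
  have hJ : J₀ ≤ J₁ := by
    refine max_le_max le_rfl ?_
    gcongr ?_ * ?_ ^ m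
    linarith
  have hJ₀12 : (12 : ℝ) ^ m ≤ J₀ := by
    refine le_trans ?_ (le_max_right _ _)
    rw [← mul_pow]
    gcongr
    linarith
  have hJ₀pos : 0 < J₀ := lt_of_lt_of_le (by positivity) hJ₀12
  have nonneg (f : FG (m + 1) P) : 0 ≤ (metricEstimate f : ℝ) := by
    have : 0 ≤ metricEstimate f := add_nonneg
      (Finset.sum_nonneg fun i _ => Finset.sum_nonneg fun p _ => abs_nonneg _)
      (Finset.sum_nonneg fun i _ => Finset.sum_nonneg fun j _ => digitSpan_nonneg _ _)
    exact_mod_cast this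
  have lower (f : FG (m + 1) P) : (metricEstimate f : ℝ) ≤ J₀ * wordLengthFG f := by
    have h1 := metricEstimate_le hP hne f
    have h2 : (metricEstimate f : ℝ) ≤ (1 + 2 * ((m + 1) * m)) * wordLengthFG f := by
      exact_mod_cast h1
    have h3 : (1 + 2 * ((m + 1) * m) : ℝ) ≤ 12 ^ m := by
      exact_mod_cast one_add_two_mul_le_pow m
    exact h2.trans (mul_le_mul_of_nonneg_right (h3.trans hJ₀12) (by positivity))
  have upper (f : FG (m + 1) P) : (wordLengthFG f : ℝ) ≤ J₁ * metricEstimate f := by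
    have h1 := wordLengthFG_le_sum hP hne f
    have h2 : (0 : ℤ) ≤ ∑ i : Fin (m + 1), ∑ p ∈ P, |diagExponent f p i| :=
      Finset.sum_nonneg fun i _ => Finset.sum_nonneg fun p _ => abs_nonneg _
    have h3 : (0 : ℤ) ≤ ∑ i : Fin (m + 1), ∑ j ∈ Finset.Ioi i,
        digitSpan (baseProd P) (entry f i j) :=
      Finset.sum_nonneg fun i _ => Finset.sum_nonneg fun j _ => digitSpan_nonneg _ _
    have hJ₁1 : 1 ≤ J₁ := (one_le_pow₀ (by norm_num)).trans (hJ₀12.trans hJ)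
    have h4 : 4 * ((P.card : ℝ) + baseProd P - 1) *
        ((∑ i : Fin (m + 1), ∑ j ∈ Finset.Ioi i, digitSpan (baseProd P) (entry f i j) : ℤ) : ℝ) ≤
        J₁ *
        ((∑ i : Fin (m + 1), ∑ j ∈ Finset.Ioi i, digitSpan (baseProd P) (entry f i j) : ℤ) : ℝ) := by
      -- For `n = 1` the constant `J₁` is only `1`, but there are no entries above the diagonal.
      -- Otherwise `4 * y ≤ 6 * y ≤ (6 * y) ^ m` with `y = P.card + baseProd P - 1`.
      rcases Nat.eq_zero_or_pos m with rfl | hm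
      · have : ∑ i : Fin (0 + 1), ∑ j ∈ Finset.Ioi i, digitSpan (baseProd P) (entry f i j) = 0 := by
          refine Finset.sum_eq_zero fun i _ => Finset.sum_eq_zero fun j hj => ?_
          have := Finset.mem_Ioi.1 hj
          omega
        rw [this]
        simp
      · refine mul_le_mul_of_nonneg_right ?_ (by exact_mod_cast h3)
        refine le_trans ?_ (le_max_right _ _)
        rw [← mul_pow]
        exact le_trans (by linarith) (le_self_pow₀ (by linarith) hm.ne')
    have h5 : (wordLengthFG f : ℝ) ≤
        ((∑ i : Fin (m + 1), ∑ p ∈ P, |diagExponent f p i| : ℤ) : ℝ) +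
        4 * ((P.card : ℝ) + baseProd P - 1) *
        ((∑ i : Fin (m + 1), ∑ j ∈ Finset.Ioi i, digitSpan (baseProd P) (entry f i j) : ℤ) : ℝ) := by
      exact_mod_cast h1
    have h6 : ((∑ i : Fin (m + 1), ∑ p ∈ P, |diagExponent f p i| : ℤ) : ℝ) ≤
        J₁ * ((∑ i : Fin (m + 1), ∑ p ∈ P, |diagExponent f p i| : ℤ) : ℝ) :=
      le_mul_of_one_le_left (by exact_mod_cast h2) hJ₁1
    rw [metricEstimate, Int.cast_add, mul_add]
    linarith
  have hJ₁pos := hJ₀pos.trans_le hJ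
  refine ⟨fun f => ⟨(exists_diagExponent hP hne f).1,
    fun i j _ h => hasDigitRange_entry hP hne f h⟩, ⟨J₁, hJ₁pos, fun f => ⟨?_, upper f⟩⟩,
    fun f => ⟨?_, upper f⟩⟩
  · rw [one_div, inv_mul_le_iff₀ hJ₁pos]
    exact (lower f).trans (mul_le_mul_of_nonneg_right hJ (by positivity))
  · rw [one_div, inv_mul_le_iff₀ hJ₀pos]
    exact lower f
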